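/- Let $X$ be any set, let $X'=\{x' : x\in X\}$ be a disjoint copy of $X$, and let $\mathcal{PI}^{\ast}_X$ be the set of all partitions of $X\cup X'$ each of whose blocks either is a one-element set (a point) or meets both $X$ and $X'$ (a generalised line). For a set $Y$ and partitions $\alpha,\beta$ of $Y\cup Y'$, the natural product $\alpha\beta$ is the partition of $Y\cup Y'$ obtained by identifying each bottom vertex $y'$ of $\alpha$ with the top vertex $y$ of $\beta$, and letting two of the remaining vertices (the top vertices of $\alpha$ and the bottom vertices of $\beta$) be in the same block if and only if they are connected in the resulting diagram. For $\alpha\in\mathcal{PI}^{\ast}_X$ let $\overline{\alpha}$ be the partition of $(X\cup\{\overline{x}\})\cup(X\cup\{\overline{x}\})'$, where $\overline{x}\notin X$, whose blocks are the generalised lines of $\alpha$ and one further block consisting of $\overline{x}$, $\overline{x}'$ and all points of $\alpha$. The map $\alpha\mapsto\overline{\alpha}$ is injective, and for $\alpha,\beta\in\mathcal{PI}^{\ast}_X$ one defines $\alpha\star\beta$ to be the unique element of $\mathcal{PI}^{\ast}_X$ with $\overline{\alpha\star\beta}=\overline{\alpha}\,\overline{\beta}$. A permutation $\pi$ in the symmetric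 group $\mathcal{S}_X$ is regarded as the element of $\mathcal{PI}^{\ast}_X$ with blocks $\{x,\pi(x)'\}$, $x\in X$. Theorem. The automorphism group $\mathrm{Aut}(\mathcal{PI}^{\ast}_X)$ of the semigroup $(\mathcal{PI}^{\ast}_X,\star)$ is isomorphic to $\mathcal{S}_X$. Moreover, for every $\varphi\in\mathrm{Aut}(\mathcal{PI}^{\ast}_X)$ there is $\pi\in\mathcal{S}_X$ such that $\varphi(a)=\pi^{-1}\star a\star\pi$ for all $a\in\mathcal{PI}^{\ast}_X$. -/

import Mathlib

universe u

/-! Vertices of a diagram: `Sum.inl x` is the top vertex `x`, `Sum.inr x` is the bottom vertex `x'`.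
A partition of `X ∪ X'` into nonempty blocks is a `Setoid (X ⊕ X)`; its blocks are its classes. -/

/-- The set of vertices `B` is a point. -/
def IsPoint {X : Type u} (B : Set (X ⊕ X)) : Prop := ∃ v, B = {v}

/-- The set of vertices `B` is a generalised line: it meets both `X` and `X'`. -/
def IsGenLine {X : Type u} (B : Set (X ⊕ X)) : Prop :=
  (∃ x, Sum.inl x ∈ B) ∧ ∃ y, Sum.inr y ∈ B

/-- `α` is placed on the upper two and `β` on the lower two of three rows of vertices,
so that the bottom vertices of `α` are identified with the top vertices of `β`. -/
inductive Stacked {X : Type u} (α β : Setoid (X ⊕ X)) : X ⊕ (X ⊕ X) → X ⊕ (X ⊕ X) → Prop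
  | upper {a b : X ⊕ X} (h : α a b) : Stacked α β (Sum.map id Sum.inl a) (Sum.map id Sum.inl b)
  | lower {a b : X ⊕ X} (h : β a b) : Stacked α β (Sum.inr a) (Sum.inr b)

/-- The natural product `αβ`: two vertices of the outer rows are in the same block if and only if
they are connected in the stacked diagram. -/
def natMul {X : Type u} (α β : Setoid (X ⊕ X)) : Setoid (X ⊕ X) :=
  Setoid.comap (Sum.map id Sum.inr) (Relation.EqvGen.setoid (Stacked α β))

/-- `I*_X`: the partitions all of whose blocks are generalised lines. -/
structure IStar (X : Type u) where
  part : Setoid (X ⊕ X)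
  genLine : ∀ B ∈ part.classes, IsGenLine B

/-- `PI*_X`: the partitions all of whose blocks are points or generalised lines. -/
@[ext]
structure PIStar (X : Type u) where
  part : Setoid (X ⊕ X)
  point_or_genLine : ∀ B ∈ part.classes, IsPoint B ∨ IsGenLine B

theorem IStar.exists_inl {X : Type u} (α : IStar X) (v : X ⊕ X) :
    ∃ x, α.part (Sum.inl x) v :=
  (α.genLine _ ⟨v, rfl⟩).1

theorem IStar.exists_inr {X : Type u} (α : IStar X) (v : X ⊕ X) :
    ∃ x, α.part (Sum.inr x) v :=
  (α.genLine _ ⟨v, rfl⟩).2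

instance {X : Type u} : Mul (IStar X) where
  mul α β :=
    { part := natMul α.part β.part
      genLine := by
        have up : ∀ x : X, ∃ y : X, natMul α.part β.part (Sum.inr y) (Sum.inl x) := by
          intro x
          obtain ⟨m, hm⟩ := α.exists_inr (Sum.inl x)
          obtain ⟨y, hy⟩ := β.exists_inr (Sum.inl m)
          exact ⟨y, .trans _ _ _ (.rel _ _ (.lower hy)) (.rel _ _ (.upper hm))⟩
        have down : ∀ y : X, ∃ x : X, natMul α.part β.part (Sum.inl x) (Sum.inr y) := by
          intro y
          obtain ⟨m, hm⟩ := β.exists_inl (Sum.inr y)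
          obtain ⟨x, hx⟩ := α.exists_inl (Sum.inr m)
          exact ⟨x, .trans _ _ _ (.rel _ _ (.upper hx)) (.rel _ _ (.lower hm))⟩
        rintro _ ⟨x | y, rfl⟩
        · exact ⟨⟨x, Setoid.refl' (natMul α.part β.part) _⟩, up x⟩
        · exact ⟨down y, ⟨y, Setoid.refl' (natMul α.part β.part) _⟩⟩ }

/-- The inclusion of the vertices over `X` into the vertices over `X ∪ {x̄}`;
`Option X` is `X ∪ {x̄}` with `x̄ = none`. -/
def emb {X : Type u} : X ⊕ X → Option X ⊕ Option X := Sum.map some some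

/-- The block of `ᾱ` consisting of `x̄`, `x̄'` and all points of `α`. -/
def PIStar.extraBlock {X : Type u} (α : PIStar X) : Set (Option X ⊕ Option X) :=
  {Sum.inl none, Sum.inr none} ∪ emb '' {v | {v} ∈ α.part.classes}

theorem emb_injective {X : Type u} : Function.Injective (emb (X := X)) :=
  Sum.map_injective.2 ⟨Option.some_injective _, Option.some_injective _⟩

theorem PIStar.emb_mem_extraBlock {X : Type u} (α : PIStar X) (v : X ⊕ X) :
    emb v ∈ α.extraBlock ↔ ∀ w, α.part w v → w = v := by
  have h1 : emb v ∈ α.extraBlock ↔ {v} ∈ α.part.classes := by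
    constructor
    · rintro (h | ⟨w, hw, h⟩)
      · rcases v with x | x <;> simp [emb] at h
      · exact emb_injective h ▸ hw
    · exact fun h => Or.inr ⟨v, h, rfl⟩
  rw [h1]
  constructor
  · rintro ⟨y, hy⟩ w hw
    have hv : α.part v y := by
      have : v ∈ ({v} : Set (X ⊕ X)) := rfl
      rwa [hy] at this
    have : w ∈ ({v} : Set (X ⊕ X)) := by
      rw [hy]; exact Setoid.trans' _ hw hv
    exact this
  · intro h
    refine ⟨v, ?_⟩
    ext w
    exact ⟨fun hw => hw ▸ Setoid.refl' _ _, fun hw => h w hw⟩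

/-- `ᾱ ∈ I*_{X ∪ {x̄}}`: its blocks are the generalised lines of `α`
and the extra block. -/
def PIStar.bar {X : Type u} (α : PIStar X) : IStar (Option X) where
  part :=
    { r := fun u v => (u ∈ α.extraBlock ∧ v ∈ α.extraBlock) ∨
        (u ∉ α.extraBlock ∧ v ∉ α.extraBlock ∧ ∃ a b, u = emb a ∧ v = emb b ∧ α.part a b)
      iseqv :=
        { refl := by
            intro u
            by_cases hu : u ∈ α.extraBlock
            · exact Or.inl ⟨hu, hu⟩
            · refine Or.inr ⟨hu, hu, ?_⟩
              rcases u with (_ | x) | (_ | x)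
              · exact absurd (Or.inl (Or.inl rfl)) hu
              · exact ⟨Sum.inl x, Sum.inl x, rfl, rfl, Setoid.refl' _ _⟩
              · exact absurd (Or.inl (Or.inr rfl)) hu
              · exact ⟨Sum.inr x, Sum.inr x, rfl, rfl, Setoid.refl' _ _⟩
          symm := by
            rintro u v (⟨hu, hv⟩ | ⟨hu, hv, a, b, ha, hb, h⟩)
            · exact Or.inl ⟨hv, hu⟩
            · exact Or.inr ⟨hv, hu, b, a, hb, ha, Setoid.symm' _ h⟩
          trans := by
            rintro u v w (⟨hu, hv⟩ | ⟨hu, hv, a, b, ha, hb, h⟩)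
              (⟨hv', hw⟩ | ⟨hv', hw, c, d, hc, hd, h'⟩)
            · exact Or.inl ⟨hu, hw⟩
            · exact absurd hv hv'
            · exact absurd hv' hv
            · have hbc : b = c := emb_injective (hb.symm.trans hc)
              subst hbc
              exact Or.inr ⟨hu, hw, a, d, ha, hd, Setoid.trans' _ h h'⟩ } }
  genLine := by
    rintro _ ⟨u, rfl⟩
    by_cases hu : u ∈ α.extraBlock
    · exact ⟨⟨none, Or.inl ⟨Or.inl (Or.inl rfl), hu⟩⟩, ⟨none, Or.inl ⟨Or.inl (Or.inr rfl), hu⟩⟩⟩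
    · obtain ⟨v, rfl⟩ : ∃ v, u = emb v := by
        rcases u with (_ | x) | (_ | x)
        · exact absurd (Or.inl (Or.inl rfl)) hu
        · exact ⟨Sum.inl x, rfl⟩
        · exact absurd (Or.inl (Or.inr rfl)) hu
        · exact ⟨Sum.inr x, rfl⟩
      have key : ∀ w, α.part w v → emb w ∉ α.extraBlock := by
        intro w hw hw'
        have h := (α.emb_mem_extraBlock w).1 hw' v (Setoid.symm' _ hw)
        exact hu (h ▸ hw')
      rcases α.point_or_genLine _ ⟨v, rfl⟩ with ⟨p, hp⟩ | ⟨⟨x, hx⟩, ⟨y, hy⟩⟩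
      · refine absurd ((α.emb_mem_extraBlock v).2 fun w hw => ?_) hu
        have h1 : w ∈ ({p} : Set (X ⊕ X)) := by rw [← hp]; exact hw
        have h2 : v ∈ ({p} : Set (X ⊕ X)) := by rw [← hp]; exact Setoid.refl' _ v
        exact h1.trans h2.symm
      · exact ⟨⟨some x, Or.inr ⟨key _ hx, hu, _, _, rfl, rfl, hx⟩⟩,
          ⟨some y, Or.inr ⟨key _ hy, hu, _, _, rfl, rfl, hy⟩⟩⟩

/-- The map inverse to `α ↦ ᾱ`, defined on the elements in which `x̄` and `x̄'` are in the same
block: the vertices in that block become points, the other blocks are kept. -/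
def IStar.unbar {X : Type u} (γ : IStar (Option X))
    (hγ : γ.part (Sum.inl none) (Sum.inr none)) : PIStar X where
  part :=
    { r := fun a b => a = b ∨ (γ.part (emb a) (emb b) ∧ ¬ γ.part (emb a) (Sum.inl none))
      iseqv :=
        { refl := fun _ => Or.inl rfl
          symm := by
            rintro a b (rfl | ⟨h, h'⟩)
            · exact Or.inl rfl
            · exact Or.inr ⟨Setoid.symm' _ h, fun h2 => h' (Setoid.trans' _ h h2)⟩
          trans := by
            rintro a b c (rfl | ⟨h, h'⟩) (rfl | ⟨k, k'⟩)
            · exact Or.inl rfl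
            · exact Or.inr ⟨k, k'⟩
            · exact Or.inr ⟨h, h'⟩
            · exact Or.inr ⟨Setoid.trans' _ h k, h'⟩ } }
  point_or_genLine := by
    rintro _ ⟨v, rfl⟩
    by_cases hv : γ.part (emb v) (Sum.inl none)
    · left
      refine ⟨v, Set.ext fun w => ⟨?_, fun h => Or.inl h⟩⟩
      rintro (h | ⟨h, h'⟩)
      · exact h
      · exact absurd (Setoid.trans' _ h hv) h'
    · right
      obtain ⟨x, hx⟩ := γ.exists_inl (emb v)
      obtain ⟨y, hy⟩ := γ.exists_inr (emb v)
      constructor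
      · rcases x with _ | x
        · exact absurd (Setoid.symm' _ hx) hv
        · exact ⟨x, Or.inr ⟨hx, fun h => hv (Setoid.trans' _ (Setoid.symm' _ hx) h)⟩⟩
      · rcases y with _ | y
        · exact absurd (Setoid.trans' _ (Setoid.symm' _ hy) (Setoid.symm' _ hγ)) hv
        · exact ⟨y, Or.inr ⟨hy, fun h => hv (Setoid.trans' _ (Setoid.symm' _ hy) h)⟩⟩

/-- `x̄` and `x̄'` are in the same block of `ᾱ β̄`. -/
theorem PIStar.bar_mul_bar_none {X : Type u} (α β : PIStar X) :
    (α.bar * β.bar).part (Sum.inl none) (Sum.inr none) := by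
  have h : ∀ γ : PIStar X, γ.bar.part (Sum.inl none) (Sum.inr none) :=
    fun _ => Or.inl ⟨Or.inl (Or.inl rfl), Or.inl (Or.inr rfl)⟩
  exact .trans _ _ _ (.rel _ _ (.upper (h α))) (.rel _ _ (.lower (h β)))

/-- `α ↦ ᾱ` is injective, with left inverse `unbar`. -/
theorem PIStar.unbar_bar {X : Type u} (α : PIStar X)
    (h : α.bar.part (Sum.inl none) (Sum.inr none)) : α.bar.unbar h = α := by
  have hn : (Sum.inl none : Option X ⊕ Option X) ∈ α.extraBlock := Or.inl (Or.inl rfl)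
  apply PIStar.ext
  apply Setoid.ext
  intro a b
  constructor
  · rintro (rfl | ⟨⟨ha, hb⟩ | ⟨ha, hb, c, d, hc, hd, hcd⟩, h2⟩)
    · exact Setoid.refl' _ _
    · exact absurd (Or.inl ⟨ha, hn⟩) h2
    · rw [emb_injective hc, emb_injective hd]
      exact hcd
  · intro hab
    by_cases hab' : a = b
    · exact Or.inl hab'
    · have ha : emb a ∉ α.extraBlock := fun h1 =>
        hab' ((α.emb_mem_extraBlock a).1 h1 b (Setoid.symm' _ hab)).symm
      have hb : emb b ∉ α.extraBlock := fun h1 =>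
        hab' ((α.emb_mem_extraBlock b).1 h1 a hab)
      refine Or.inr ⟨Or.inr ⟨ha, hb, a, b, rfl, rfl, hab⟩, ?_⟩
      rintro (⟨h1, -⟩ | ⟨-, h1, -⟩)
      · exact ha h1
      · exact h1 hn

/-- An element in which `x̄` and `x̄'` are in the same block is in the image of `α ↦ ᾱ`. -/
theorem IStar.bar_unbar {X : Type u} (γ : IStar (Option X))
    (hγ : γ.part (Sum.inl none) (Sum.inr none)) : (γ.unbar hγ).bar.part = γ.part := by
  have key : ∀ u, u ∈ (γ.unbar hγ).extraBlock ↔ γ.part u (Sum.inl none) := by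
    have hemb : ∀ v : X ⊕ X,
        emb v ∈ (γ.unbar hγ).extraBlock ↔ γ.part (emb v) (Sum.inl none) := by
      intro v
      rw [PIStar.emb_mem_extraBlock]
      constructor
      · intro h
        by_contra hv
        rcases v with x | x
        · obtain ⟨_ | y, hy⟩ := γ.exists_inr (emb (Sum.inl x))
          · exact hv (Setoid.trans' _ (Setoid.symm' _ hy) (Setoid.symm' _ hγ))
          · have := h (Sum.inr y)
              (Or.inr ⟨hy, fun h' => hv (Setoid.trans' _ (Setoid.symm' _ hy) h')⟩)
            simp at this
        · obtain ⟨_ | y, hy⟩ := γ.exists_inl (emb (Sum.inr x))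
          · exact hv (Setoid.symm' _ hy)
          · have := h (Sum.inl y)
              (Or.inr ⟨hy, fun h' => hv (Setoid.trans' _ (Setoid.symm' _ hy) h')⟩)
            simp at this
      · rintro h w (h' | ⟨h1, h2⟩)
        · exact h'
        · exact absurd (Setoid.trans' _ h1 h) h2
    rintro ((_ | x) | (_ | x))
    · exact ⟨fun _ => Setoid.refl' _ _, fun _ => Or.inl (Or.inl rfl)⟩
    · exact hemb (Sum.inl x)
    · exact ⟨fun _ => Setoid.symm' _ hγ, fun _ => Or.inl (Or.inr rfl)⟩
    · exact hemb (Sum.inr x)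
  apply Setoid.ext
  intro u v
  constructor
  · rintro (⟨hu, hv⟩ | ⟨hu, hv, a, b, rfl, rfl, h⟩)
    · exact Setoid.trans' _ ((key u).1 hu) (Setoid.symm' _ ((key v).1 hv))
    · rcases h with rfl | h
      · exact Setoid.refl' _ _
      · exact h.1
  · intro h
    by_cases hu : γ.part u (Sum.inl none)
    · exact Or.inl ⟨(key u).2 hu, (key v).2 (Setoid.trans' _ (Setoid.symm' _ h) hu)⟩
    · have hv : ¬ γ.part v (Sum.inl none) := fun h' => hu (Setoid.trans' _ h h')
      have ex : ∀ w, ¬ γ.part w (Sum.inl none) → ∃ a, w = emb a := by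
        rintro ((_ | x) | (_ | x)) hw
        · exact absurd (Setoid.refl' _ _) hw
        · exact ⟨Sum.inl x, rfl⟩
        · exact absurd (Setoid.symm' _ hγ) hw
        · exact ⟨Sum.inr x, rfl⟩
      obtain ⟨a, rfl⟩ := ex u hu
      obtain ⟨b, rfl⟩ := ex v hv
      exact Or.inr ⟨fun h' => hu ((key _).1 h'), fun h' => hv ((key _).1 h'), a, b, rfl, rfl,
        Or.inr ⟨h, hu⟩⟩

/-- The product `α ⋆ β`, the preimage of `ᾱ β̄` under `α ↦ ᾱ`. -/
instance {X : Type u} : Mul (PIStar X) where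
  mul α β := (α.bar * β.bar).unbar (α.bar_mul_bar_none β)

theorem PIStar.bar_mul {X : Type u} (α β : PIStar X) :
    (α * β).bar.part = natMul α.bar.part β.bar.part :=
  IStar.bar_unbar _ _

/-- `S_X` inside `PI*_X`: the permutation `π` is the partition into the lines `{x, π(x)'}`. -/
def PIStar.ofPerm {X : Type u} (π : Equiv.Perm X) : PIStar X where
  part := Setoid.ker (Sum.elim π id)
  point_or_genLine := by
    rintro _ ⟨x | y, rfl⟩
    · exact Or.inr ⟨⟨x, rfl⟩, ⟨π x, rfl⟩⟩
    · exact Or.inr ⟨⟨π.symm y, π.apply_symm_apply y⟩, ⟨y, rfl⟩⟩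

section

variable {X : Type u}

/-! The idea is to work with `bar`, where the product is the natural product, and to let
automorphisms act on the idempotents `collapse x`. Multiplying by `collapse x` on the left or right
merges the block of `x` (resp. `x'`) with the extra block (`bar_collapse_mul`, `bar_mul_collapse`),
so equations involving these idempotents detect which vertices are connected.

They are characterised algebraically: the `collapse x` are exactly the nonidentity idempotents `α`
for which `α * γ = α` with `γ` an involution forces `γ` to be the identity (`isFreeIdem_collapse`,
`IsFreeIdem.exists_eq_collapse`). Every automorphism therefore permutes them, which yields a
permutation `π` of `X`. Conjugation by `π` permutes them in the same way (`conj_collapse`), and an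
automorphism fixing all of them is trivial (`eq_one_of_map_collapse`). Hence `conj` is an
isomorphism onto the automorphism group. -/

theorem PIStar.bar_part_injective {α β : PIStar X} (h : α.bar.part = β.bar.part) : α = β := by
  have hn : ∀ γ : PIStar X, γ.bar.part (Sum.inl none) (Sum.inr none) :=
    fun _ => Or.inl ⟨Or.inl (Or.inl rfl), Or.inl (Or.inr rfl)⟩
  have hb : ∀ γ δ : IStar (Option X), γ.part = δ.part → γ = δ := by
    rintro ⟨_, _⟩ ⟨_, _⟩ rfl
    rfl
  rw [← α.unbar_bar (hn α), ← β.unbar_bar (hn β)]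
  congr 1
  exact hb _ _ h

theorem PIStar.bar_none (α : PIStar X) : α.bar.part (Sum.inl none) (Sum.inr none) :=
  Or.inl ⟨Or.inl (Or.inl rfl), Or.inl (Or.inr rfl)⟩

/-! ### Bounds for the natural product -/

/-- The connectedness relation is the least equivalence containing both diagrams, so any equivalence
`S` on the three rows that contains them bounds it. In applications `S` is usually pulled back along
a map folding the three rows onto two. -/
theorem natMul_le {α β : Setoid (X ⊕ X)} {S : Setoid (X ⊕ (X ⊕ X))}
    (hα : ∀ a b, α a b → S (Sum.map id Sum.inl a) (Sum.map id Sum.inl b))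
    (hβ : ∀ a b, β a b → S (Sum.inr a) (Sum.inr b)) :
    natMul α β ≤ S.comap (Sum.map id Sum.inr) := by
  have h : Relation.EqvGen.setoid (Stacked α β) ≤ S := by
    refine Setoid.eqvGen_le ?_
    rintro _ _ (h | h)
    · exact hα _ _ h
    · exact hβ _ _ h
  exact fun a b hab => h hab

theorem natMul_inl {α β : Setoid (X ⊕ X)} {x y : X} (h : α (Sum.inl x) (Sum.inl y)) :
    natMul α β (Sum.inl x) (Sum.inl y) :=
  .rel _ _ (.upper h)

theorem natMul_inr {α β : Setoid (X ⊕ X)} {x y : X} (h : β (Sum.inr x) (Sum.inr y)) :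
    natMul α β (Sum.inr x) (Sum.inr y) :=
  .rel _ _ (.lower h)

theorem natMul_inl_inr {α β : Setoid (X ⊕ X)} {x y z : X} (h : α (Sum.inl x) (Sum.inr y))
    (h' : β (Sum.inl y) (Sum.inr z)) : natMul α β (Sum.inl x) (Sum.inr z) :=
  .trans _ _ _ (.rel _ _ (.upper h)) (.rel _ _ (.lower h'))

/-- The natural product commutes with renaming the vertices. -/
theorem natMul_comap_equiv {Y : Type u} (τ : Y ≃ X) (α β : Setoid (X ⊕ X)) :
    natMul (α.comap (Sum.map τ τ)) (β.comap (Sum.map τ τ)) =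
      (natMul α β).comap (Sum.map τ τ) := by
  have key : ∀ {Y Z : Type u} (f : Y → Z) (α β : Setoid (Y ⊕ Y)) (γ δ : Setoid (Z ⊕ Z)),
      α ≤ γ.comap (Sum.map f f) → β ≤ δ.comap (Sum.map f f) →
      natMul α β ≤ (natMul γ δ).comap (Sum.map f f) := by
    intro Y Z f α β γ δ h h' a b hab
    have := natMul_le (S := (Relation.EqvGen.setoid (Stacked γ δ)).comap
      (Sum.map f (Sum.map f f))) (fun a b hab => ?_) (fun a b hab => ?_) hab
    · rcases a with a | a <;> rcases b with b | b <;> exact this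
    · have := Relation.EqvGen.rel _ _ (Stacked.upper (β := δ) (h hab))
      rcases a with a | a <;> rcases b with b | b <;> exact this
    · exact .rel _ _ (.lower (h' hab))
  -- The reverse inclusion is the same fact for `τ.symm`.
  refine le_antisymm (key τ _ _ _ _ le_rfl le_rfl) fun a b hab => ?_
  have hinv : ∀ γ : Setoid (X ⊕ X),
      γ ≤ (γ.comap (Sum.map τ τ)).comap (Sum.map τ.symm τ.symm) := by
    intro γ a b h
    rcases a with a | a <;> rcases b with b | b <;> simpa [Setoid.comap_rel] using h
  have := key τ.symm _ _ _ _ (hinv α) (hinv β) hab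
  rcases a with a | a <;> rcases b with b | b <;> simpa [Setoid.comap_rel] using this

/-! ### Permutations and conjugation -/

/-- A permutation diagram has no points, so its extra block is `{x̄, x̄'}` and `π` is simply
extended by fixing `x̄`. -/
theorem PIStar.bar_ofPerm (π : Equiv.Perm X) :
    (PIStar.ofPerm π).bar.part = Setoid.ker (Sum.elim (Option.map π) id) := by
  have hs : ∀ v, emb v ∉ (PIStar.ofPerm π).extraBlock := by
    intro v hv
    rw [PIStar.emb_mem_extraBlock] at hv
    rcases v with x | x
    · exact Sum.inr_ne_inl (hv (Sum.inr (π x)) rfl)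
    · exact Sum.inl_ne_inr (hv (Sum.inl (π.symm x)) (π.apply_symm_apply x))
  have hker : ∀ a b, Sum.elim (Option.map π) id (emb a) = Sum.elim (Option.map π) id (emb b) ↔
      Sum.elim π id a = Sum.elim π id b := by
    rintro (a | a) (b | b) <;> simp [emb]
  have hnone : ∀ u, u ∈ (PIStar.ofPerm π).extraBlock ↔
      Sum.elim (Option.map π) id u = none := by
    rintro ((_ | x) | (_ | x))
    · exact iff_of_true (Or.inl (Or.inl rfl)) rfl
    · exact iff_of_false (hs (Sum.inl x)) (Option.some_ne_none _)
    · exact iff_of_true (Or.inl (Or.inr rfl)) rfl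
    · exact iff_of_false (hs (Sum.inr x)) (Option.some_ne_none _)
  apply Setoid.ext
  intro u v
  rw [Setoid.ker_def]
  constructor
  · rintro (⟨hu, hv⟩ | ⟨-, -, a, b, rfl, rfl, h⟩)
    · rw [(hnone u).1 hu, (hnone v).1 hv]
    · exact (hker a b).2 h
  · intro h
    by_cases hu : u ∈ (PIStar.ofPerm π).extraBlock
    · exact Or.inl ⟨hu, (hnone v).2 (h ▸ (hnone u).1 hu)⟩
    · have hv : v ∉ (PIStar.ofPerm π).extraBlock := by rwa [hnone, ← h, ← hnone]
      have ex : ∀ w, w ∉ (PIStar.ofPerm π).extraBlock → ∃ a, w = emb a := by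
        rintro ((_ | x) | (_ | x)) hw
        · exact absurd ((hnone _).2 rfl) hw
        · exact ⟨Sum.inl x, rfl⟩
        · exact absurd ((hnone _).2 rfl) hw
        · exact ⟨Sum.inr x, rfl⟩
      obtain ⟨a, rfl⟩ := ex u hu
      obtain ⟨b, rfl⟩ := ex v hv
      exact Or.inr ⟨hu, hv, a, b, rfl, rfl, (hker a b).1 h⟩

theorem PIStar.bar_ofPerm_mul (π : Equiv.Perm X) (α : PIStar X) :
    (PIStar.ofPerm π * α).bar.part = α.bar.part.comap (Sum.map (Option.map π) id) := by
  rw [PIStar.bar_mul, PIStar.bar_ofPerm]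
  apply le_antisymm
  · intro a b hab
    -- Fold the top row onto the middle one along `π`; the upper diagram then becomes trivial.
    have := natMul_le (S := α.bar.part.comap (Sum.elim (fun u => Sum.inl (Option.map π u)) id))
      (fun a b hab => ?_) (fun a b hab => hab) hab
    · rcases a with a | a <;> rcases b with b | b <;> exact this
    · have h : ∀ c : Option X ⊕ Option X,
          Sum.elim (fun u => Sum.inl (Option.map π u)) id (Sum.map id Sum.inl c) =
            (Sum.inl (Sum.elim (Option.map π) id c) : Option X ⊕ Option X) := by
        rintro (c | c) <;> rfl
      rw [Setoid.comap_rel, h, h, show Sum.elim (Option.map π) id a = _ from hab]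
  · intro a b hab
    have h : ∀ c : Option X ⊕ Option X, Relation.EqvGen
        (Stacked (Setoid.ker (Sum.elim (Option.map π) id)) α.bar.part)
        (Sum.map id Sum.inr c) (Sum.inr (Sum.map (Option.map π) id c)) := by
      rintro (c | c)
      · exact .rel _ _ (.upper (a := Sum.inl c) (b := Sum.inr (Option.map π c)) rfl)
      · exact .refl _
    exact .trans _ _ _ (h a) (.trans _ _ _ (.rel _ _ (.lower hab)) (.symm _ _ (h b)))

theorem PIStar.bar_mul_ofPerm (π : Equiv.Perm X) (α : PIStar X) :
    (α * PIStar.ofPerm π).bar.part = α.bar.part.comap (Sum.map id (Option.map π.symm)) := by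
  rw [PIStar.bar_mul, PIStar.bar_ofPerm]
  apply le_antisymm
  · intro a b hab
    have := natMul_le (S := α.bar.part.comap
        (Sum.map id (Sum.elim id (Option.map π.symm))))
      (fun a b hab => ?_) (fun a b hab => ?_) hab
    · rcases a with a | a <;> rcases b with b | b <;> exact this
    · rcases a with a | a <;> rcases b with b | b <;> exact hab
    · have h : ∀ c : Option X ⊕ Option X, Sum.elim id (Option.map π.symm) c =
          Option.map π.symm (Sum.elim (Option.map π) id c) := by
        rintro (c | c) <;> simp
      rw [Setoid.comap_rel, Sum.map_inr, Sum.map_inr, h, h,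
        show Sum.elim (Option.map π) id a = _ from hab]
  · intro a b hab
    have h : ∀ c : Option X ⊕ Option X, Relation.EqvGen
        (Stacked α.bar.part (Setoid.ker (Sum.elim (Option.map π) id)))
        (Sum.map id Sum.inr c)
        (Sum.map id Sum.inl (Sum.map id (Option.map π.symm) c)) := by
      rintro (c | c)
      · exact .refl _
      · refine .rel _ _ (.lower (a := Sum.inr c) (b := Sum.inl (Option.map π.symm c)) ?_)
        simp [Setoid.ker_def]
    exact .trans _ _ _ (h a) (.trans _ _ _ (.rel _ _ (.upper hab)) (.symm _ _ (h b)))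

theorem PIStar.ofPerm_one_mul (α : PIStar X) : PIStar.ofPerm 1 * α = α := by
  apply PIStar.bar_part_injective
  rw [PIStar.bar_ofPerm_mul]
  apply Setoid.ext
  simp [Setoid.comap_rel]

theorem PIStar.mul_ofPerm_one (α : PIStar X) : α * PIStar.ofPerm 1 = α := by
  apply PIStar.bar_part_injective
  rw [PIStar.bar_mul_ofPerm]
  apply Setoid.ext
  simp [Setoid.comap_rel, ← Equiv.Perm.inv_def]

theorem PIStar.ofPerm_mul_ofPerm (π τ : Equiv.Perm X) :
    PIStar.ofPerm π * PIStar.ofPerm τ = PIStar.ofPerm (τ * π) := by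
  apply PIStar.bar_part_injective
  rw [PIStar.bar_ofPerm_mul, PIStar.bar_ofPerm, PIStar.bar_ofPerm]
  apply Setoid.ext
  rintro (a | a) (b | b) <;> simp [Setoid.ker_def, Equiv.Perm.coe_mul]

theorem PIStar.ofPerm_injective : Function.Injective (PIStar.ofPerm (X := X)) := by
  intro π τ h
  ext x
  have h1 : (PIStar.ofPerm π).part (Sum.inl x) (Sum.inr (π x)) := rfl
  rw [h] at h1
  exact (show τ x = π x from h1).symm

/-- The left factor renames the top row and the right factor the bottom row, by the same bijection.
Multiplicativity of conjugation thus reduces to `natMul_comap_equiv`. -/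
theorem PIStar.bar_conj (π : Equiv.Perm X) (α : PIStar X) :
    (PIStar.ofPerm π⁻¹ * α * PIStar.ofPerm π).bar.part =
      α.bar.part.comap (Sum.map π.symm.optionCongr π.symm.optionCongr) := by
  rw [PIStar.bar_mul_ofPerm, PIStar.bar_ofPerm_mul]
  apply Setoid.ext
  rintro (a | a) (b | b) <;> rfl

/-- Conjugation by permutations. -/
def PIStar.conj : Equiv.Perm X →* MulAut (PIStar X) where
  toFun π :=
    { toFun := fun α => PIStar.ofPerm π⁻¹ * α * PIStar.ofPerm π
      invFun := fun α => PIStar.ofPerm π⁻¹⁻¹ * α * PIStar.ofPerm π⁻¹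
      left_inv := fun α => by
        have h : ∀ a : Option X, π.symm.optionCongr ((π⁻¹).symm.optionCongr a) = a := by
          rintro (_ | a)
          · rfl
          · exact congrArg some (π.symm_apply_apply a)
        apply PIStar.bar_part_injective
        rw [PIStar.bar_conj, PIStar.bar_conj]
        apply Setoid.ext
        rintro (a | a) (b | b) <;> simp only [Setoid.comap_rel, Sum.map_inl, Sum.map_inr, h]
      right_inv := fun α => by
        apply PIStar.bar_part_injective
        rw [PIStar.bar_conj, PIStar.bar_conj]
        apply Setoid.ext
        rintro (a | a) (b | b) <;> simp [Setoid.comap_rel, ← Equiv.Perm.inv_def]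
      map_mul' := fun α β => by
        apply PIStar.bar_part_injective
        rw [PIStar.bar_conj, PIStar.bar_mul, PIStar.bar_mul, PIStar.bar_conj, PIStar.bar_conj,
          natMul_comap_equiv] }
  map_one' := by
    ext1 α
    change PIStar.ofPerm 1⁻¹ * α * PIStar.ofPerm 1 = α
    rw [inv_one, PIStar.ofPerm_one_mul, PIStar.mul_ofPerm_one]
  map_mul' π τ := by
    ext1 α
    apply PIStar.bar_part_injective
    change (PIStar.ofPerm (π * τ)⁻¹ * α * PIStar.ofPerm (π * τ)).bar.part =
      (PIStar.ofPerm π⁻¹ * (PIStar.ofPerm τ⁻¹ * α * PIStar.ofPerm τ) * PIStar.ofPerm π).bar.part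
    rw [PIStar.bar_conj, PIStar.bar_conj, PIStar.bar_conj]
    apply Setoid.ext
    rintro (a | a) (b | b) <;>
      simp [Setoid.comap_rel, ← Equiv.Perm.inv_def, Equiv.Perm.coe_mul, Function.comp_def]

theorem PIStar.conj_apply (π : Equiv.Perm X) (α : PIStar X) :
    PIStar.conj π α = PIStar.ofPerm π⁻¹ * α * PIStar.ofPerm π := rfl

/-! ### Merging classes and the idempotents `collapse x` -/

/-- The equivalence relation obtained from `S` by joining the classes of `a` and `b`. -/
def Setoid.merge {Y : Type u} (S : Setoid Y) (a b : Y) : Setoid Y where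
  r c d := S c d ∨ ((S c a ∨ S c b) ∧ (S d a ∨ S d b))
  iseqv :=
    { refl := fun c => Or.inl (S.refl' c)
      symm := by
        rintro c d (h | h)
        · exact Or.inl (S.symm' h)
        · exact Or.inr h.symm
      trans := by
        rintro c d e (h | ⟨h, h'⟩) (k | ⟨k, k'⟩)
        · exact Or.inl (S.trans' h k)
        · exact Or.inr ⟨k.imp (S.trans' h) (S.trans' h), k'⟩
        · exact Or.inr ⟨h, h'.imp (S.trans' (S.symm' k)) (S.trans' (S.symm' k))⟩
        · exact Or.inr ⟨h, k'⟩ }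

theorem Setoid.merge_le {Y : Type u} {S T : Setoid Y} {a b : Y} (h : S ≤ T) (hab : T a b) :
    S.merge a b ≤ T := by
  have key : ∀ c, S c a ∨ S c b → T c b := fun c hc =>
    hc.elim (fun hc => T.trans' (h hc) hab) fun hc => h hc
  rintro c d (hcd | ⟨hc, hd⟩)
  · exact h hcd
  · exact T.trans' (key c hc) (T.symm' (key d hd))

theorem Setoid.merge_congr {Y : Type u} {S : Setoid Y} {a a' b b' : Y} (ha : S a a')
    (hb : S b b') : S.merge a b = S.merge a' b' := by
  apply le_antisymm <;> refine Setoid.merge_le (fun _ _ h => Or.inl h) (Or.inr ⟨?_, ?_⟩)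
  · exact Or.inl ha
  · exact Or.inr hb
  · exact Or.inl (S.symm' ha)
  · exact Or.inr (S.symm' hb)

theorem Setoid.merge_eq_self {Y : Type u} {S : Setoid Y} {a b : Y} :
    S.merge a b = S ↔ S a b := by
  refine ⟨fun h => ?_, fun h => ?_⟩
  · rw [← h]
    exact Or.inr ⟨Or.inl (S.refl' _), Or.inr (S.refl' _)⟩
  · exact le_antisymm (Setoid.merge_le le_rfl h) fun _ _ h => Or.inl h

/-- The idempotent whose points are `x` and `x'` and whose other blocks are the lines
`{y, y'}`. -/
def PIStar.collapse (x : X) : PIStar X :=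
  IStar.unbar
    { part := ((⊥ : Setoid (Option X)).merge (some x) none).comap (Sum.elim id id)
      genLine := by
        rintro _ ⟨v, rfl⟩
        exact ⟨⟨Sum.elim id id v, Or.inl rfl⟩, ⟨Sum.elim id id v, Or.inl rfl⟩⟩ }
    (Or.inl rfl)

theorem PIStar.bar_collapse (x : X) : (PIStar.collapse x).bar.part =
    ((⊥ : Setoid (Option X)).merge (some x) none).comap (Sum.elim id id) :=
  IStar.bar_unbar _ _

theorem PIStar.bar_collapse_rel {x : X} {a b : Option X ⊕ Option X} :
    (PIStar.collapse x).bar.part a b ↔ Sum.elim id id a = Sum.elim id id b ∨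
      ((Sum.elim id id a = some x ∨ Sum.elim id id a = none) ∧
        (Sum.elim id id b = some x ∨ Sum.elim id id b = none)) := by
  rw [PIStar.bar_collapse]
  rfl

/-- The upper diagram joins each top vertex to the one below it and, beyond that, only links the
columns of `x` and `x̄`. Consequently `collapse x * α = α` tests whether `x` lies in the extra
block. -/
theorem PIStar.bar_collapse_mul (x : X) (α : PIStar X) :
    (PIStar.collapse x * α).bar.part =
      α.bar.part.merge (Sum.inl (some x)) (Sum.inl none) := by
  rw [PIStar.bar_mul]
  apply le_antisymm
  · intro a b hab
    have := natMul_le (S := (α.bar.part.merge (Sum.inl (some x)) (Sum.inl none)).comap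
        (Sum.elim Sum.inl id))
      (fun a b hab => ?_) (fun a b hab => Or.inl hab) hab
    · rcases a with a | a <;> rcases b with b | b <;> exact this
    · have h : ∀ c : Option X ⊕ Option X,
          Sum.elim Sum.inl id (Sum.map id Sum.inl c) =
            (Sum.inl (Sum.elim id id c) : Option X ⊕ Option X) := by
        rintro (c | c) <;> rfl
      rw [Setoid.comap_rel, h, h]
      have hr : ∀ c d : Option X, c = d →
        α.bar.part (Sum.inl c) (Sum.inl d) := fun c d h => h ▸ Setoid.refl' _ _
      rcases PIStar.bar_collapse_rel.1 hab with h | ⟨h, h'⟩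
      · exact Or.inl (hr _ _ h)
      · exact Or.inr ⟨h.imp (hr _ _) (hr _ _), h'.imp (hr _ _) (hr _ _)⟩
  · refine Setoid.merge_le (fun a b hab => ?_) (natMul_inl ?_)
    · have h : ∀ c : Option X ⊕ Option X, Relation.EqvGen
          (Stacked (PIStar.collapse x).bar.part α.bar.part) (Sum.map id Sum.inr c)
            (Sum.inr c) := by
        rintro (c | c)
        · exact .rel _ _ (.upper (a := Sum.inl c) (b := Sum.inr c)
            (PIStar.bar_collapse_rel.2 (Or.inl rfl)))
        · exact .refl _
      exact .trans _ _ _ (h a) (.trans _ _ _ (.rel _ _ (.lower hab)) (.symm _ _ (h b)))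
    · exact PIStar.bar_collapse_rel.2 (Or.inr ⟨Or.inl rfl, Or.inr rfl⟩)

theorem PIStar.bar_mul_collapse (x : X) (α : PIStar X) :
    (α * PIStar.collapse x).bar.part =
      α.bar.part.merge (Sum.inr (some x)) (Sum.inr none) := by
  rw [PIStar.bar_mul]
  apply le_antisymm
  · intro a b hab
    have := natMul_le (S := (α.bar.part.merge (Sum.inr (some x)) (Sum.inr none)).comap
        (Sum.map id (Sum.elim id id)))
      (fun a b hab => ?_) (fun a b hab => ?_) hab
    · rcases a with a | a <;> rcases b with b | b <;> exact this
    · rcases a with a | a <;> rcases b with b | b <;> exact Or.inl hab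
    · have hr : ∀ c d : Option X, c = d →
        α.bar.part (Sum.inr c) (Sum.inr d) := fun c d h => h ▸ Setoid.refl' _ _
      rcases PIStar.bar_collapse_rel.1 hab with h | ⟨h, h'⟩
      · exact Or.inl (hr _ _ h)
      · exact Or.inr ⟨h.imp (hr _ _) (hr _ _), h'.imp (hr _ _) (hr _ _)⟩
  · refine Setoid.merge_le (fun a b hab => ?_) (natMul_inr ?_)
    · have h : ∀ c : Option X ⊕ Option X, Relation.EqvGen
          (Stacked α.bar.part (PIStar.collapse x).bar.part) (Sum.map id Sum.inr c)
            (Sum.map id Sum.inl c) := by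
        rintro (c | c)
        · exact .refl _
        · exact .rel _ _ (.lower (a := Sum.inr c) (b := Sum.inl c)
            (PIStar.bar_collapse_rel.2 (Or.inl rfl)))
      exact .trans _ _ _ (h a) (.trans _ _ _ (.rel _ _ (.upper hab)) (.symm _ _ (h b)))
    · exact PIStar.bar_collapse_rel.2 (Or.inr ⟨Or.inl rfl, Or.inr rfl⟩)

theorem PIStar.collapse_injective : Function.Injective (PIStar.collapse (X := X)) := by
  intro x y h
  have h1 : (PIStar.collapse x).bar.part (Sum.inl (some x)) (Sum.inl none) :=
    PIStar.bar_collapse_rel.2 (Or.inr ⟨Or.inl rfl, Or.inr rfl⟩)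
  rw [h, PIStar.bar_collapse_rel] at h1
  simpa using h1

theorem PIStar.conj_collapse (π : Equiv.Perm X) (x : X) :
    PIStar.conj π (PIStar.collapse x) = PIStar.collapse (π x) := by
  apply PIStar.bar_part_injective
  rw [PIStar.conj_apply, PIStar.bar_conj]
  apply Setoid.ext
  intro a b
  rw [Setoid.comap_rel, PIStar.bar_collapse_rel, PIStar.bar_collapse_rel]
  have h : ∀ c : Option X ⊕ Option X,
      Sum.elim id id (Sum.map π.symm.optionCongr π.symm.optionCongr c) =
        π.symm.optionCongr (Sum.elim id id c) := by
    rintro (c | c) <;> rfl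
  have h' : ∀ c : Option X, π.symm.optionCongr c = some x ↔ c = some (π x) := by
    rintro (_ | c) <;> simp [Equiv.symm_apply_eq]
  have h'' : ∀ c : Option X, π.symm.optionCongr c = none ↔ c = none :=
    fun c => Option.map_eq_none_iff
  rw [h, h, h', h', h'', h'', EmbeddingLike.apply_eq_iff_eq]

/-! ### Automorphisms fixing every `collapse x` -/

/-- An automorphism fixing every `collapse x` can only coarsen partitions. -/
theorem PIStar.bar_le_of_map_collapse {φ : MulAut (PIStar X)}
    (hφ : ∀ x, φ (PIStar.collapse x) = PIStar.collapse x) (α : PIStar X) :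
    α.bar.part ≤ (φ α).bar.part := by
  -- Lying in the block of `x̄` is the equation `collapse x * α = α`, which `φ` preserves and
  -- reflects.
  have htop : ∀ x, α.bar.part (Sum.inl x) (Sum.inl none) →
      (φ α).bar.part (Sum.inl x) (Sum.inl none) := by
    rintro (_ | x) h
    · exact Setoid.refl' _ _
    · rw [← Setoid.merge_eq_self, ← PIStar.bar_collapse_mul] at h ⊢
      rw [← hφ x, ← map_mul, PIStar.bar_part_injective h]
  have htop' : ∀ x, (φ α).bar.part (Sum.inl x) (Sum.inl none) →
      α.bar.part (Sum.inl x) (Sum.inl none) := by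
    rintro (_ | x) h
    · exact Setoid.refl' _ _
    · rw [← Setoid.merge_eq_self, ← PIStar.bar_collapse_mul] at h ⊢
      rw [← hφ x, ← map_mul] at h
      rw [φ.injective (PIStar.bar_part_injective h)]
  have hbot : ∀ x, α.bar.part (Sum.inr x) (Sum.inr none) →
      (φ α).bar.part (Sum.inr x) (Sum.inr none) := by
    rintro (_ | x) h
    · exact Setoid.refl' _ _
    · rw [← Setoid.merge_eq_self, ← PIStar.bar_mul_collapse] at h ⊢
      rw [← hφ x, ← map_mul, PIStar.bar_part_injective h]
  have hnone : ∀ x y, α.bar.part (Sum.inl x) (Sum.inr y) →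
      α.bar.part (Sum.inl x) (Sum.inl none) → (φ α).bar.part (Sum.inl x) (Sum.inr y) := by
    intro x y h h'
    have h1 := hbot y (Setoid.trans' _ (Setoid.symm' _ h) (Setoid.trans' _ h' α.bar_none))
    exact Setoid.trans' _ (htop x h') (Setoid.trans' _ (φ α).bar_none (Setoid.symm' _ h1))
  have hcross : ∀ x y, α.bar.part (Sum.inl x) (Sum.inr y) →
      (φ α).bar.part (Sum.inl x) (Sum.inr y) := by
    rintro (_ | x) (_ | y) h
    · exact (φ α).bar_none
    · exact hnone _ _ h (Setoid.refl' _ _)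
    · exact hnone _ _ h (Setoid.trans' _ h (Setoid.symm' _ α.bar_none))
    · by_cases hx : (φ α).bar.part (Sum.inl (some x)) (Sum.inl none)
      · exact hnone _ _ h (htop' _ hx)
      -- Since `x` and `y'` share a block, merging that block with the extra block from above or
      -- from below has the same effect; `φ` carries the equation over to `φ α`.
      have h1 : PIStar.collapse x * α = α * PIStar.collapse y := by
        apply PIStar.bar_part_injective
        rw [PIStar.bar_collapse_mul, PIStar.bar_mul_collapse]
        exact Setoid.merge_congr h α.bar_none
      have h2 := congrArg φ h1
      rw [map_mul, map_mul, hφ, hφ] at h2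
      have h3 : (PIStar.collapse x * φ α).bar.part (Sum.inl (some x)) (Sum.inl none) := by
        rw [PIStar.bar_collapse_mul]
        exact Or.inr ⟨Or.inl (Setoid.refl' _ _), Or.inr (Setoid.refl' _ _)⟩
      -- On the right-hand side `x` is linked to `x̄` only by the merge, so in `φ α` it already lies
      -- in the block of `y'` or in that of `x̄'`; the latter is excluded by `hx`.
      rw [h2, PIStar.bar_mul_collapse] at h3
      rcases h3 with h3 | ⟨h3 | h3, -⟩
      · exact absurd h3 hx
      · exact h3
      · exact absurd (Setoid.trans' _ h3 (Setoid.symm' _ (φ α).bar_none)) hx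
  -- Every block of `α.bar` meets both rows, so relations within a row factor through the opposite
  -- row.
  rintro (x | x) (y | y) h
  · obtain ⟨z, hz⟩ := α.bar.exists_inr (Sum.inl x)
    have hz' := Setoid.symm' _ hz
    exact Setoid.trans' _ (hcross x z hz')
      (Setoid.symm' _ (hcross y z (Setoid.trans' _ (Setoid.symm' _ h) hz')))
  · exact hcross x y h
  · exact Setoid.symm' _ (hcross y x (Setoid.symm' _ h))
  · obtain ⟨z, hz⟩ := α.bar.exists_inl (Sum.inr x)
    exact Setoid.trans' _ (Setoid.symm' _ (hcross z x hz)) (hcross z y (Setoid.trans' _ hz h))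

theorem PIStar.eq_one_of_map_collapse {φ : MulAut (PIStar X)}
    (hφ : ∀ x, φ (PIStar.collapse x) = PIStar.collapse x) : φ = 1 := by
  ext1 α
  apply PIStar.bar_part_injective
  refine le_antisymm ?_ (PIStar.bar_le_of_map_collapse hφ α)
  have hinv : ∀ x, φ⁻¹ (PIStar.collapse x) = PIStar.collapse x := fun x => by
    rw [MulAut.inv_apply, MulEquiv.symm_apply_eq, hφ]
  -- Coarsening by `φ⁻¹`, applied at `φ α`, is the reverse inclusion.
  simpa using PIStar.bar_le_of_map_collapse hinv (φ α)

/-! ### Algebraic characterisation of the `collapse x` -/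

/-- The nonidentity idempotents not fixed by right multiplication by a nonidentity involution. -/
def PIStar.IsFreeIdem (α : PIStar X) : Prop :=
  α * α = α ∧ α ≠ PIStar.ofPerm 1 ∧
    ∀ γ, γ * γ = PIStar.ofPerm 1 → α * γ = α → γ = PIStar.ofPerm 1

theorem PIStar.map_ofPerm_one (φ : MulAut (PIStar X)) :
    φ (PIStar.ofPerm 1) = PIStar.ofPerm 1 := by
  rw [← PIStar.mul_ofPerm_one (φ (PIStar.ofPerm 1))]
  apply φ.symm.injective
  rw [map_mul, MulEquiv.symm_apply_apply, PIStar.ofPerm_one_mul]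

theorem PIStar.IsFreeIdem.map {α : PIStar X} (h : α.IsFreeIdem) (φ : MulAut (PIStar X)) :
    (φ α).IsFreeIdem := by
  obtain ⟨h1, h2, h3⟩ := h
  refine ⟨by rw [← map_mul, h1], fun h => h2 (φ.injective ?_), fun γ hγ hα => ?_⟩
  · rw [h, PIStar.map_ofPerm_one]
  · obtain ⟨γ, rfl⟩ := φ.surjective γ
    rw [← map_mul, ← PIStar.map_ofPerm_one φ, EmbeddingLike.apply_eq_iff_eq] at hγ
    rw [← map_mul, EmbeddingLike.apply_eq_iff_eq] at hα
    rw [h3 γ hγ hα, PIStar.map_ofPerm_one]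

/-- If `t` is linked to `u'` and `u` to `w'`, then `α * α` links `t` to `w'`; idempotence closes the
chain `u, w', t, u'`. An idempotent is thus given by an equivalence on the columns. -/
theorem PIStar.bar_inl_inr_of_mul_self {α : PIStar X} (h : α * α = α) (u : Option X) :
    α.bar.part (Sum.inl u) (Sum.inr u) := by
  obtain ⟨t, ht⟩ := α.bar.exists_inl (Sum.inr u)
  obtain ⟨w, hw⟩ := α.bar.exists_inr (Sum.inl u)
  have hw' := Setoid.symm' _ hw
  have h1 : (α * α).bar.part (Sum.inl t) (Sum.inr w) := by
    rw [PIStar.bar_mul]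
    exact natMul_inl_inr ht hw'
  rw [h] at h1
  exact Setoid.trans' _ hw' (Setoid.trans' _ (Setoid.symm' _ h1) ht)

theorem PIStar.bar_ofPerm_one_rel {a b : Option X ⊕ Option X} :
    (PIStar.ofPerm (1 : Equiv.Perm X)).bar.part a b ↔
      Sum.elim id id a = Sum.elim id id b := by
  rw [PIStar.bar_ofPerm, Setoid.ker_def]
  rcases a with a | a <;> rcases b with b | b <;> simp

theorem PIStar.isFreeIdem_collapse (x : X) : (PIStar.collapse x).IsFreeIdem := by
  refine ⟨?_, fun h => ?_, fun γ hγ hx => ?_⟩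
  · apply PIStar.bar_part_injective
    rw [PIStar.bar_collapse_mul, Setoid.merge_eq_self]
    exact PIStar.bar_collapse_rel.2 (Or.inr ⟨Or.inl rfl, Or.inr rfl⟩)
  · have h1 : (PIStar.collapse x).bar.part (Sum.inl (some x)) (Sum.inl none) :=
      PIStar.bar_collapse_rel.2 (Or.inr ⟨Or.inl rfl, Or.inr rfl⟩)
    rw [h, PIStar.bar_ofPerm_one_rel] at h1
    exact Option.some_ne_none x h1
  -- An involution links no two top vertices, as such links survive in `γ * γ`.
  · have hinj : ∀ u v, γ.bar.part (Sum.inl u) (Sum.inl v) → u = v := by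
      intro u v h
      have h1 : (γ * γ).bar.part (Sum.inl u) (Sum.inl v) := by
        rw [PIStar.bar_mul]
        exact natMul_inl h
      rw [hγ, PIStar.bar_ofPerm_one_rel] at h1
      exact h1
    have hfix : ∀ u v, γ.bar.part (Sum.inl u) (Sum.inr v) →
        (PIStar.collapse x).bar.part (Sum.inl u) (Sum.inr v) := by
      intro u v h
      rw [← hx, PIStar.bar_mul]
      exact natMul_inl_inr (PIStar.bar_collapse_rel.2 (Or.inl rfl)) h
    have hdiag : ∀ u, γ.bar.part (Sum.inl u) (Sum.inr u) := by
      have hne : ∀ u, u ≠ some x → γ.bar.part (Sum.inl u) (Sum.inr u) := by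
        rintro (_ | u) hu
        · exact γ.bar_none
        · obtain ⟨v, hv⟩ := γ.bar.exists_inr (Sum.inl (some u))
          have hv' := Setoid.symm' _ hv
          rcases PIStar.bar_collapse_rel.1 (hfix _ _ hv') with h | ⟨h | h, -⟩
          · have h' : some u = v := h
            rwa [← h'] at hv'
          · exact absurd h hu
          · exact absurd h (Option.some_ne_none u)
      intro u
      by_cases hu : u = some x
      · obtain ⟨v, hv⟩ := γ.bar.exists_inr (Sum.inl u)
        by_cases hvu : v = u
        · rw [hvu] at hv
          exact Setoid.symm' _ hv
        -- The other columns are already fixed by `γ`, so `x` linked to `v'` with `v` in another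
        -- column would link the top vertices `v` and `x`.
        · exact absurd (hinj _ _ (Setoid.trans' _ (hne v (hu ▸ hvu)) hv)) hvu
      · exact hne u hu
    have hid : ∀ c, γ.bar.part (Sum.inl (Sum.elim id id c)) c := by
      rintro (c | c)
      · exact Setoid.refl' _ _
      · exact hdiag c
    apply PIStar.bar_part_injective
    apply Setoid.ext
    intro a b
    rw [PIStar.bar_ofPerm_one_rel]
    constructor
    · exact fun h => hinj _ _ (Setoid.trans' _ (hid a)
        (Setoid.trans' _ h (Setoid.symm' _ (hid b))))
    · intro h
      have h1 := hid a
      rw [h] at h1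
      exact Setoid.trans' _ (Setoid.symm' _ h1) (hid b)

theorem PIStar.IsFreeIdem.exists_eq_collapse {α : PIStar X} (h : α.IsFreeIdem) :
    ∃ x, α = PIStar.collapse x := by
  classical
  obtain ⟨hα, h1, hfree⟩ := h
  have hdiag := PIStar.bar_inl_inr_of_mul_self hα
  have hid : ∀ c, α.bar.part (Sum.inl (Sum.elim id id c)) c := by
    rintro (c | c)
    · exact Setoid.refl' _ _
    · exact hdiag c
  have hrel : ∀ a b, α.bar.part a b ↔
      α.bar.part (Sum.inl (Sum.elim id id a)) (Sum.inl (Sum.elim id id b)) := fun a b =>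
    ⟨fun h => Setoid.trans' _ (hid a) (Setoid.trans' _ h (Setoid.symm' _ (hid b))),
      fun h => Setoid.trans' _ (Setoid.symm' _ (hid a)) (Setoid.trans' _ h (hid b))⟩
  have hsome : ∀ x y, α.bar.part (Sum.inl (some x)) (Sum.inl (some y)) → x = y := by
    intro x y hxy
    -- Swapping two columns in one block does not change `α`, so freeness forces the swap to be
    -- trivial: each block contains at most one column from `X`.
    have hswap : PIStar.ofPerm (Equiv.swap x y) = PIStar.ofPerm 1 := by
      refine hfree _ ?_ ?_
      · rw [PIStar.ofPerm_mul_ofPerm, Equiv.swap_mul_self]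
      · have hs : ∀ c, α.bar.part (Sum.inr (Option.map (Equiv.swap x y) c)) (Sum.inr c) := by
          have hxy' := (hrel (Sum.inr (some x)) (Sum.inr (some y))).2 hxy
          rintro (_ | c)
          · exact Setoid.refl' _ _
          · rw [Option.map_some]
            by_cases hx : c = x
            · rw [hx, Equiv.swap_apply_left]
              exact Setoid.symm' _ hxy'
            by_cases hy : c = y
            · rw [hy, Equiv.swap_apply_right]
              exact hxy'
            · rw [Equiv.swap_apply_of_ne_of_ne hx hy]
        have hs' : ∀ c, α.bar.part
            (Sum.map id (Option.map (Equiv.swap x y)) c) c := by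
          rintro (c | c)
          · exact Setoid.refl' _ _
          · exact hs c
        apply PIStar.bar_part_injective
        rw [PIStar.bar_mul_ofPerm, Equiv.symm_swap]
        apply Setoid.ext
        intro a b
        rw [Setoid.comap_rel]
        exact ⟨fun h => Setoid.trans' _ (Setoid.symm' _ (hs' a)) (Setoid.trans' _ h (hs' b)),
          fun h => Setoid.trans' _ (hs' a) (Setoid.trans' _ h (Setoid.symm' _ (hs' b)))⟩
    exact Equiv.swap_eq_one_iff.1 (PIStar.ofPerm_injective hswap)
  -- If no column were joined to `x̄`, all columns would be separate and `α` would be the identity.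
  obtain ⟨x, hx⟩ : ∃ x, α.bar.part (Sum.inl (some x)) (Sum.inl none) := by
    by_contra! hn
    refine h1 (PIStar.bar_part_injective (Setoid.ext fun a b => ?_))
    rw [PIStar.bar_ofPerm_one_rel, hrel]
    generalize Sum.elim id id a = u
    generalize Sum.elim id id b = v
    refine ⟨fun h => ?_, fun h => h ▸ Setoid.refl' _ _⟩
    rcases u with _ | u <;> rcases v with _ | v
    · rfl
    · exact absurd (Setoid.symm' _ h) (hn v)
    · exact absurd h (hn u)
    · rw [hsome u v h]
  have hnone : ∀ u, α.bar.part (Sum.inl u) (Sum.inl none) → u = some x ∨ u = none := by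
    rintro (_ | u) hu
    · exact Or.inr rfl
    · exact Or.inl (congrArg some (hsome u x (Setoid.trans' _ hu (Setoid.symm' _ hx))))
  have hnone' : ∀ u, u = some x ∨ u = none → α.bar.part (Sum.inl u) (Sum.inl none) := by
    rintro _ (rfl | rfl)
    · exact hx
    · exact Setoid.refl' _ _
  refine ⟨x, PIStar.bar_part_injective (Setoid.ext fun a b => ?_)⟩
  rw [PIStar.bar_collapse_rel, hrel]
  generalize Sum.elim id id a = u
  generalize Sum.elim id id b = v
  constructor
  · intro h
    by_cases hu : α.bar.part (Sum.inl u) (Sum.inl none)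
    · exact Or.inr ⟨hnone u hu, hnone v (Setoid.trans' _ (Setoid.symm' _ h) hu)⟩
    · rcases u with _ | u
      · exact absurd (Setoid.refl' _ _) hu
      · rcases v with _ | v
        · exact absurd h hu
        · exact Or.inl (congrArg some (hsome u v h))
  · rintro (rfl | ⟨h, h'⟩)
    · exact Setoid.refl' _ _
    · exact Setoid.trans' _ (hnone' u h) (Setoid.symm' _ (hnone' v h'))

/-! ### From automorphisms to permutations -/

theorem PIStar.exists_perm_map_collapse (φ : MulAut (PIStar X)) :
    ∃ π : Equiv.Perm X, ∀ x, φ (PIStar.collapse x) = PIStar.collapse (π x) := by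
  have h : ∀ (ψ : MulAut (PIStar X)) (x : X), ∃ y, ψ (PIStar.collapse x) = PIStar.collapse y :=
    fun ψ x => ((PIStar.isFreeIdem_collapse x).map ψ).exists_eq_collapse
  choose f hf using h φ
  choose g hg using h φ⁻¹
  refine ⟨⟨f, g, fun x => PIStar.collapse_injective ?_, fun x => PIStar.collapse_injective ?_⟩, hf⟩
  · rw [← hg, ← hf, MulAut.inv_apply_self]
  · rw [← hf, ← hg, MulAut.apply_inv_self]

theorem PIStar.conj_bijective : Function.Bijective (PIStar.conj (X := X)) := by
  constructor
  · rw [injective_iff_map_eq_one]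
    intro π hπ
    ext x
    apply PIStar.collapse_injective
    rw [← PIStar.conj_collapse, hπ]
    rfl
  · intro φ
    obtain ⟨π, hπ⟩ := PIStar.exists_perm_map_collapse φ
    -- The automorphism `(conj π)⁻¹ * φ` fixes every `collapse x`.
    refine ⟨π, (inv_mul_eq_one.1 (PIStar.eq_one_of_map_collapse fun x => ?_))⟩
    rw [MulAut.mul_apply, hπ, ← PIStar.conj_collapse, MulAut.inv_apply_self]

end

theorem mainTheorem2 (X : Type u) :
    Nonempty (MulAut (PIStar X) ≃* Equiv.Perm X) ∧
      ∀ φ : MulAut (PIStar X), ∃ π : Equiv.Perm X, ∀ a : PIStar X,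
        φ a = PIStar.ofPerm π⁻¹ * a * PIStar.ofPerm π := by
  refine ⟨⟨(MulEquiv.ofBijective PIStar.conj PIStar.conj_bijective).symm⟩, fun φ => ?_⟩
  obtain ⟨π, rfl⟩ := PIStar.conj_bijective.2 φ
  exact ⟨π, PIStar.conj_apply π⟩
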